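/- For a finite simple graph $G=(V,E)$, its line graph $L(G)$ is the graph with vertex set $E$ in which two distinct edges of $G$ are adjacent if and only if they share an endpoint; put $L^{(0)}(G)=G$ and $L^{(j+1)}(G)=L(L^{(j)}(G))$ for $j\ge 0$. Two finite trees $G$ and $H$ are called Graham equivalent if $L^{(j)}(G)$ and $L^{(j)}(H)$ have the same number of vertices for every $j\ge 0$; the equivalence classes are called Graham classes. Theorem. There is a constant $c>0$ such that the number of Graham classes of trees on $n$ vertices is $\Omega\bigl(e^{c(\log n)^{3/2}}\bigr)$ as $n\to\infty$; that is, there are constants $c,C>0$ and $n_0$ such that for every integer $n\ge n_0$ there are at least $C\,e^{c(\log n)^{3/2}}$ Graham classes of trees on $n$ vertices. -/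

import Mathlib

open Filter Asymptotics

universe u v

/-- The `j`-th iterated line graph of `G`, bundled with its vertex type:
`L^(0)(G) = G` and `L^(j+1)(G) = L(L^(j)(G))`. -/
def iteratedLineGraph {V : Type u} (G : SimpleGraph V) : ℕ → Σ W : Type u, SimpleGraph W
  | 0 => ⟨V, G⟩
  | j + 1 => ⟨(iteratedLineGraph G j).2.edgeSet, (iteratedLineGraph G j).2.lineGraph⟩

/-- The number of vertices of the `j`-th iterated line graph of a finite graph. -/
noncomputable def iteratedLineGraphOrder {V : Type u} [Finite V] (G : SimpleGraph V) (j : ℕ) : ℕ :=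
  Nat.card (iteratedLineGraph G j).1

/-- Graham equivalence: all the iterated line graphs have the same orders. -/
def GrahamEquivalent {V : Type u} {W : Type v} [Finite V] [Finite W]
    (G : SimpleGraph V) (H : SimpleGraph W) : Prop :=
  ∀ j : ℕ, iteratedLineGraphOrder G j = iteratedLineGraphOrder H j

/-- Trees on the vertex set `Fin n`. Every tree on `n` vertices is isomorphic to one of these. -/
def TreeOn (n : ℕ) : Type := {G : SimpleGraph (Fin n) // G.IsTree}

/-- Graham equivalence as an equivalence relation on the trees on `n` vertices. -/
def grahamSetoid (n : ℕ) : Setoid (TreeOn n) where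
  r G H := GrahamEquivalent G.1 H.1
  iseqv := ⟨fun _ _ => rfl, fun h j => (h j).symm, fun h₁ h₂ j => (h₁ j).trans (h₂ j)⟩

/-- The number of Graham classes of trees on `n` vertices. -/
noncomputable def numGrahamClasses (n : ℕ) : ℕ := Nat.card (Quotient (grahamSetoid n))

/-! A string of `K` bits is coded by a caterpillar whose leaf clusters lie far apart. The bit `i`
decides whether the spine vertex of block `i` has degree `2 * i + 6` or loses two leaves to a nearby
vertex. Let `i` be the largest index where two strings differ, and compare edge counts of the `j`-th
line graphs. By locality (`edgeCount_le_add`), everything that does not stay far to the right of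
block `i`, where the trees agree, lives within distance O(`j`) of the part up to block `i`. If the
bit is off, edges there have degree sum at most `2 * i + 6`; if it is on, one star has degree sums
at least `2 * i + 7`. The star's faster growth beats all the other edges once `j` is of order `i *
log n` (`edgeCount_lt_edgeCount`), so the counts differ.

Hence all `2 ^ K` codes are inequivalent (`edgeCount_codeTree_injective`). They fit on `n` vertices
for `K` up to order `n ^ (1/3)`; taking `K` of order `(log n) ^ 2` is already enough. -/

/-! ### Line graphs of subgraphs on a common vertex type -/

/-- The line graph of `G`, realised on all unordered pairs of vertices of `G`; the pairs that are
not edges of `G` are isolated. -/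
def edgeGraph {α : Type u} (G : SimpleGraph α) : SimpleGraph (Sym2 α) where
  Adj e f := e ≠ f ∧ e ∈ G.edgeSet ∧ f ∈ G.edgeSet ∧ ∃ x, x ∈ e ∧ x ∈ f
  symm := ⟨fun _ _ ⟨h, he, hf, x, hxe, hxf⟩ => ⟨h.symm, hf, he, x, hxf, hxe⟩⟩
  loopless := ⟨fun _ h => h.1 rfl⟩

/-- The number of edges of the `j`-th iterated line graph. -/
noncomputable def edgeCount : ℕ → ∀ {α : Type u}, SimpleGraph α → ℕ
  | 0, _, G => G.edgeSet.ncard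
  | j + 1, _, G => edgeCount j (edgeGraph G)

/-- The subgraph of `G` of the edges with both ends satisfying `P`. -/
def restrictTo {α : Type u} (G : SimpleGraph α) (P : α → Prop) : SimpleGraph α where
  Adj x y := G.Adj x y ∧ P x ∧ P y
  symm := ⟨fun _ _ ⟨h, hx, hy⟩ => ⟨h.symm, hy, hx⟩⟩
  loopless := ⟨fun _ h => h.1.ne rfl⟩

theorem restrictTo_le {α : Type u} (G : SimpleGraph α) (P : α → Prop) : restrictTo G P ≤ G :=
  fun _ _ h => h.1

theorem mem_edgeSet_restrictTo {α : Type u} (G : SimpleGraph α) (P : α → Prop) (e : Sym2 α) :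
    e ∈ (restrictTo G P).edgeSet ↔ e ∈ G.edgeSet ∧ ∀ x ∈ e, P x := by
  induction e with
  | _ x y => simp [restrictTo]

/-- Keeping non-edges as isolated vertices lets restriction commute with the line graph on the nose,
so inductions on `j` need no transport between types. -/
theorem edgeGraph_restrictTo {α : Type u} (G : SimpleGraph α) (P : α → Prop) :
    edgeGraph (restrictTo G P) = restrictTo (edgeGraph G) (fun e => ∀ x ∈ e, P x) := by
  ext e f
  simp only [edgeGraph, mem_edgeSet_restrictTo]
  simp only [restrictTo]
  tauto

theorem edgeGraph_mono {α : Type u} {G H : SimpleGraph α} (h : G ≤ H) :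
    edgeGraph G ≤ edgeGraph H := by
  rintro e f ⟨hne, he, hf, hx⟩
  exact ⟨hne, SimpleGraph.edgeSet_mono h he, SimpleGraph.edgeSet_mono h hf, hx⟩

theorem edgeGraph_disjoint {α : Type u} {G H : SimpleGraph α}
    (h : Disjoint G.edgeSet H.edgeSet) :
    Disjoint (edgeGraph G).edgeSet (edgeGraph H).edgeSet := by
  rw [Set.disjoint_left] at h ⊢
  intro e
  induction e with
  | _ x y => exact fun hG hH => h hG.2.1 hH.2.1

/-! ### Superadditivity and locality of edge counts -/

theorem edgeCount_add_le {j : ℕ} : ∀ {α : Type u} [Finite α] {G H K : SimpleGraph α},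
    H ≤ G → K ≤ G → Disjoint H.edgeSet K.edgeSet →
    edgeCount j H + edgeCount j K ≤ edgeCount j G := by
  induction j with
  | zero =>
    intro α _ G H K hH hK hd
    have := Fintype.ofFinite α
    simp only [edgeCount]
    rw [← Set.ncard_union_eq hd]
    exact Set.ncard_le_ncard
      (Set.union_subset (SimpleGraph.edgeSet_mono hH) (SimpleGraph.edgeSet_mono hK))
  | succ j ih =>
    intro α _ G H K hH hK hd
    have := Fintype.ofFinite α
    exact ih (edgeGraph_mono hH) (edgeGraph_mono hK) (edgeGraph_disjoint hd)

/-- If everything outside of `P` lies in `Q s`, and neighbours of `Q t` lie in `Q (t + 1)`, then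
the pairs counted by `edgeCount j G` live on `P` or on `Q (s + j + 1)`. -/
theorem edgeCount_le_add {j : ℕ} : ∀ {α : Type u} [Finite α] {G : SimpleGraph α}
    {P : α → Prop} {Q : ℕ → α → Prop} {s : ℕ}, Monotone Q →
    (∀ x y, G.Adj x y → ¬ P x → Q s x) → (∀ t x y, G.Adj x y → Q t x → Q (t + 1) y) →
    edgeCount j G ≤ edgeCount j (restrictTo G P) + edgeCount j (restrictTo G (Q (s + j + 1))) := by
  induction j with
  | zero =>
    intro α _ G P Q s hQ hP hadj
    have := Fintype.ofFinite α
    simp only [edgeCount]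
    refine le_trans (Set.ncard_le_ncard ?_) (Set.ncard_union_le _ _)
    intro e
    induction e with
    | _ x y =>
      intro h
      have h' : G.Adj x y := h
      by_cases hx : P x
      · by_cases hy : P y
        · exact Or.inl ⟨h', hx, hy⟩
        · have h1 := hP y x h'.symm hy
          exact Or.inr ⟨h', hadj _ _ _ h'.symm h1, hQ (Nat.le_succ s) _ h1⟩
      · have h1 := hP x y h' hx
        exact Or.inr ⟨h', hQ (Nat.le_succ s) _ h1, hadj _ _ _ h' h1⟩
  | succ j ih =>
    intro α _ G P Q s hQ hP hadj
    have := Fintype.ofFinite α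
    simp only [edgeCount, edgeGraph_restrictTo]
    -- An edge with one end in `Q s` has both ends in `Q (s + 1)`; hence the shift of `s`.
    have := ih (G := edgeGraph G) (P := fun e => ∀ x ∈ e, P x) (Q := fun t e => ∀ x ∈ e, Q t x)
      (s := s + 1) (fun a b hab e he x hx => hQ hab _ (he x hx)) ?_ ?_
    · rwa [show s + (j + 1) + 1 = s + 1 + j + 1 by ring]
    · rintro e f ⟨-, he, -, -⟩ hnot
      push Not at hnot
      obtain ⟨x, hx, hPx⟩ := hnot
      obtain ⟨y, rfl⟩ := Sym2.mem_iff_exists.1 hx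
      have he' : G.Adj x y := he
      have h1 := hP x y he' hPx
      intro z hz
      rcases Sym2.mem_iff.1 hz with rfl | rfl
      · exact hQ (Nat.le_succ s) _ h1
      · exact hadj _ _ _ he' h1
    · rintro t e f ⟨-, -, hf, x, hxe, hxf⟩ hQe
      obtain ⟨y, rfl⟩ := Sym2.mem_iff_exists.1 hxf
      have h1 := hQe x hxe
      intro z hz
      rcases Sym2.mem_iff.1 hz with rfl | rfl
      · exact hQ (Nat.le_succ t) _ h1
      · exact hadj _ _ _ hf h1

/-! ### Growth of edge counts under degree bounds -/

theorem ncard_incidenceSet {α : Type u} (G : SimpleGraph α) (x : α) :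
    (G.incidenceSet x).ncard = (G.neighborSet x).ncard := by
  classical
  exact Nat.card_congr (G.incidenceSetEquivNeighborSet x)

theorem ncard_neighborSet_edgeGraph {α : Type u} [Finite α] (G : SimpleGraph α) {x y : α}
    (h : G.Adj x y) : ((edgeGraph G).neighborSet s(x, y)).ncard + 2 =
      (G.neighborSet x).ncard + (G.neighborSet y).ncard := by
  have := Fintype.ofFinite α
  have h1 : (edgeGraph G).neighborSet s(x, y) =
      (G.incidenceSet x ∪ G.incidenceSet y) \ {s(x, y)} := by
    ext f
    simp only [SimpleGraph.mem_neighborSet, edgeGraph, SimpleGraph.incidenceSet, Set.mem_sdiff,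
      Set.mem_union, Set.mem_ofPred_eq, Set.mem_singleton_iff, Sym2.mem_iff]
    constructor
    · rintro ⟨hne, -, hf, z, rfl | rfl, hz⟩
      · exact ⟨Or.inl ⟨hf, hz⟩, hne.symm⟩
      · exact ⟨Or.inr ⟨hf, hz⟩, hne.symm⟩
    · rintro ⟨⟨hf, hz⟩ | ⟨hf, hz⟩, hne⟩
      · exact ⟨Ne.symm hne, h, hf, x, Or.inl rfl, hz⟩
      · exact ⟨Ne.symm hne, h, hf, y, Or.inr rfl, hz⟩
  have hmem : s(x, y) ∈ G.incidenceSet x ∪ G.incidenceSet y :=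
    Or.inl ⟨h, Sym2.mem_mk_left _ _⟩
  have h2 := Set.ncard_union_add_ncard_inter (G.incidenceSet x) (G.incidenceSet y)
  rw [G.incidenceSet_inter_incidenceSet_of_adj h, Set.ncard_singleton, ncard_incidenceSet,
    ncard_incidenceSet] at h2
  have h3 := Set.ncard_sdiff_singleton_add_one hmem
  rw [h1]
  omega

theorem two_mul_ncard_edgeSet {α : Type u} [Fintype α] (G : SimpleGraph α) :
    2 * G.edgeSet.ncard = ∑ x, (G.neighborSet x).ncard := by
  classical
  have := G.sum_degrees_eq_twice_card_edges
  rw [← SimpleGraph.coe_edgeFinset, Set.ncard_coe_finset, ← this]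
  refine Finset.sum_congr rfl fun x _ => ?_
  rw [← SimpleGraph.card_neighborSet_eq_degree, ← Nat.card_eq_fintype_card, Nat.card_coe_set_eq]

theorem two_mul_ncard_edgeSet_edgeGraph {α : Type u} [Fintype α] (G : SimpleGraph α) :
    2 * (edgeGraph G).edgeSet.ncard =
      ∑ e ∈ (Set.toFinite G.edgeSet).toFinset, ((edgeGraph G).neighborSet e).ncard := by
  classical
  rw [two_mul_ncard_edgeSet]
  symm
  refine Finset.sum_subset (Finset.subset_univ _) fun e _ he => ?_
  rw [Set.Finite.mem_toFinset] at he
  have : (edgeGraph G).neighborSet e = ∅ := by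
    ext f
    simp only [SimpleGraph.mem_neighborSet, edgeGraph, Set.mem_empty_iff_false, iff_false]
    exact fun h => he h.2.1
  rw [this, Set.ncard_empty]

/-- Degree sums at most `a + 4` give degrees at most `a + 2` in the line graph, so degree sums at
most `2 * a + 4`: the excess `a` doubles at each step. -/
theorem two_pow_mul_edgeCount_le {j : ℕ} : ∀ {α : Type u} [Finite α] {G : SimpleGraph α} {a : ℕ},
    (∀ x y, G.Adj x y → (G.neighborSet x).ncard + (G.neighborSet y).ncard ≤ a + 4) →
    2 ^ j * edgeCount j G ≤ G.edgeSet.ncard * ∏ i ∈ Finset.range j, (2 ^ i * a + 2) := by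
  induction j with
  | zero => intro α _ G a _; simp [edgeCount]
  | succ j ih =>
    intro α _ G a h
    have := Fintype.ofFinite α
    have hdeg : ∀ e ∈ G.edgeSet, ((edgeGraph G).neighborSet e).ncard ≤ a + 2 := by
      intro e
      induction e with
      | _ x y =>
        intro he
        have h1 := ncard_neighborSet_edgeGraph G (x := x) (y := y) he
        have h2 := h x y he
        omega
    have h1 := ih (G := edgeGraph G) (a := 2 * a) fun e f hef => by
      have := hdeg e hef.2.1
      have := hdeg f hef.2.2.1
      omega
    have h2 : 2 * (edgeGraph G).edgeSet.ncard ≤ G.edgeSet.ncard * (a + 2) := by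
      rw [two_mul_ncard_edgeSet_edgeGraph, Set.ncard_eq_toFinset_card, ← smul_eq_mul]
      exact Finset.sum_le_card_nsmul _ _ _ fun e he => hdeg e (by simpa using he)
    rw [Finset.prod_range_succ', pow_succ']
    calc 2 * 2 ^ j * edgeCount (j + 1) G = 2 * (2 ^ j * edgeCount j (edgeGraph G)) := by
          rw [edgeCount, mul_assoc]
      _ ≤ 2 * ((edgeGraph G).edgeSet.ncard * ∏ i ∈ Finset.range j, (2 ^ i * (2 * a) + 2)) := by
          gcongr
      _ = 2 * (edgeGraph G).edgeSet.ncard * ∏ i ∈ Finset.range j, (2 ^ (i + 1) * a + 2) := by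
          rw [mul_assoc]
          simp only [pow_succ, mul_assoc]
      _ ≤ G.edgeSet.ncard * (a + 2) * ∏ i ∈ Finset.range j, (2 ^ (i + 1) * a + 2) := by gcongr
      _ = _ := by ring

theorem le_two_pow_mul_edgeCount {j : ℕ} : ∀ {α : Type u} [Finite α] {G : SimpleGraph α} {a : ℕ},
    (∀ x y, G.Adj x y → a + 4 ≤ (G.neighborSet x).ncard + (G.neighborSet y).ncard) →
    G.edgeSet.ncard * ∏ i ∈ Finset.range j, (2 ^ i * a + 2) ≤ 2 ^ j * edgeCount j G := by
  induction j with
  | zero => intro α _ G a _; simp [edgeCount]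
  | succ j ih =>
    intro α _ G a h
    have := Fintype.ofFinite α
    have hdeg : ∀ e ∈ G.edgeSet, a + 2 ≤ ((edgeGraph G).neighborSet e).ncard := by
      intro e
      induction e with
      | _ x y =>
        intro he
        have h1 := ncard_neighborSet_edgeGraph G (x := x) (y := y) he
        have h2 := h x y he
        omega
    have h1 := ih (G := edgeGraph G) (a := 2 * a) fun e f hef => by
      have := hdeg e hef.2.1
      have := hdeg f hef.2.2.1
      omega
    have h2 : G.edgeSet.ncard * (a + 2) ≤ 2 * (edgeGraph G).edgeSet.ncard := by
      rw [two_mul_ncard_edgeSet_edgeGraph, Set.ncard_eq_toFinset_card, ← smul_eq_mul]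
      exact Finset.card_nsmul_le_sum _ _ _ fun e he => hdeg e (by simpa using he)
    rw [Finset.prod_range_succ', pow_succ']
    calc _ = G.edgeSet.ncard * (a + 2) * ∏ i ∈ Finset.range j, (2 ^ (i + 1) * a + 2) := by ring
      _ ≤ 2 * (edgeGraph G).edgeSet.ncard * ∏ i ∈ Finset.range j, (2 ^ (i + 1) * a + 2) := by
          gcongr
      _ = 2 * ((edgeGraph G).edgeSet.ncard * ∏ i ∈ Finset.range j, (2 ^ i * (2 * a) + 2)) := by
          rw [mul_assoc]
          simp only [pow_succ, mul_assoc]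
      _ ≤ 2 * (2 ^ j * edgeCount j (edgeGraph G)) := by gcongr
      _ = 2 * 2 ^ j * edgeCount (j + 1) G := by rw [edgeCount, mul_assoc]

/-! ### Comparison with the iterated line graphs -/

theorem edgeGraph_map {α β : Type u} (G : SimpleGraph α) (f : α ↪ β) :
    edgeGraph (G.map f) = G.lineGraph.map
      ((Function.Embedding.subtype _).trans ⟨Sym2.map f, Sym2.map.injective f.injective⟩) := by
  ext e e'
  simp only [edgeGraph, SimpleGraph.edgeSet_map, SimpleGraph.map_adj, SimpleGraph.lineGraph]
  constructor
  · rintro ⟨hne, ⟨a, ha, rfl⟩, ⟨b, hb, rfl⟩, x, hxa, hxb⟩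
    obtain ⟨y, hya, rfl⟩ := Sym2.mem_map.1 hxa
    obtain ⟨z, hzb, hz⟩ := Sym2.mem_map.1 hxb
    obtain rfl := f.injective hz
    refine ⟨⟨a, ha⟩, ⟨b, hb⟩, ⟨?_, z, hya, hzb⟩, rfl, rfl⟩
    rintro h
    cases h
    exact hne rfl
  · rintro ⟨⟨a, ha⟩, ⟨b, hb⟩, ⟨hne, x, hxa, hxb⟩, rfl, rfl⟩
    refine ⟨fun h => hne (Subtype.ext (Sym2.map.injective f.injective h)), ⟨a, ha, rfl⟩,
      ⟨b, hb, rfl⟩, f x, Sym2.mem_map.2 ⟨x, hxa, rfl⟩, Sym2.mem_map.2 ⟨x, hxb, rfl⟩⟩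

theorem edgeCount_map {j : ℕ} : ∀ {α β : Type u} (G : SimpleGraph α) (f : α ↪ β),
    edgeCount j (G.map f) = edgeCount j G := by
  induction j with
  | zero =>
    intro α β G f
    simp only [edgeCount, SimpleGraph.edgeSet_map]
    exact Set.ncard_image_of_injective _ (Sym2.map.injective f.injective)
  | succ j ih =>
    have key : ∀ {α β : Type u} (G : SimpleGraph α) (f : α ↪ β),
        edgeCount (j + 1) (G.map f) = edgeCount j G.lineGraph := by
      intro α β G f
      rw [edgeCount, edgeGraph_map, ih]
    intro α β G f
    have h := key G (Function.Embedding.refl α)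
    rw [key, ← h]
    congr 1
    ext x y
    simp

theorem edgeCount_succ {j : ℕ} {α : Type u} (G : SimpleGraph α) :
    edgeCount (j + 1) G = edgeCount j G.lineGraph := by
  rw [← edgeCount_map G (Function.Embedding.refl α), edgeCount, edgeGraph_map, edgeCount_map]

/-- `edgeCount` takes the next line graph at the inner end, `iteratedLineGraph` at the outer end;
the free starting level `k` reconciles the two recursions. -/
theorem card_iteratedLineGraph {V : Type u} (G : SimpleGraph V) (j : ℕ) : ∀ k : ℕ,
    Nat.card (iteratedLineGraph G (k + j + 1)).1 = edgeCount j (iteratedLineGraph G k).2 := by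
  induction j with
  | zero => intro k; rfl
  | succ j ih =>
    intro k
    rw [edgeCount_succ, show k + (j + 1) + 1 = (k + 1) + j + 1 by ring, ih]
    rfl

theorem iteratedLineGraphOrder_succ {V : Type u} [Finite V] (G : SimpleGraph V) (j : ℕ) :
    iteratedLineGraphOrder G (j + 1) = edgeCount j G := by
  have := card_iteratedLineGraph G j 0
  rw [zero_add] at this
  exact this

/-! ### Comparison of two growth rates -/

theorem pow_succ_add_mul_pow_le (x n : ℕ) : x ^ (n + 1) + (n + 1) * x ^ n ≤ (x + 1) ^ (n + 1) := by
  induction n with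
  | zero => simp
  | succ n ih =>
    calc x ^ (n + 1 + 1) + (n + 1 + 1) * x ^ (n + 1)
        ≤ (x ^ (n + 1) + (n + 1) * x ^ n) * (x + 1) := by
          have : 0 ≤ (n + 1) * x ^ n := Nat.zero_le _
          ring_nf at this ⊢
          omega
      _ ≤ (x + 1) ^ (n + 1) * (x + 1) := by gcongr
      _ = (x + 1) ^ (n + 1 + 1) := by ring

theorem two_mul_pow_le (c : ℕ) : 2 * (c + 2) ^ (c + 2) ≤ (c + 3) ^ (c + 2) := by
  have h := pow_succ_add_mul_pow_le (c + 2) (c + 1)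
  have e : (c + 1 + 1) * (c + 2) ^ (c + 1) = (c + 2) ^ (c + 2) := by ring
  rw [e] at h
  rw [two_mul]
  exact h

/-- Each step gains a factor at least `(c + 3) / (c + 2)` for `H` over `G`. By Bernoulli, `c + 2`
steps gain a factor 2, so `(c + 2) * m` steps outweigh the fewer than `2 ^ m` edges of `G`. -/
theorem edgeCount_lt_edgeCount {α β : Type u} [Finite α] [Finite β] {H : SimpleGraph α}
    {G : SimpleGraph β} {c m : ℕ} (hne : 0 < H.edgeSet.ncard)
    (hH : ∀ x y, H.Adj x y → c + 5 ≤ (H.neighborSet x).ncard + (H.neighborSet y).ncard)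
    (hG : ∀ x y, G.Adj x y → (G.neighborSet x).ncard + (G.neighborSet y).ncard ≤ c + 4)
    (hm : G.edgeSet.ncard < 2 ^ m) :
    edgeCount ((c + 2) * m) G < edgeCount ((c + 2) * m) H := by
  set j := (c + 2) * m with hj
  have h1 := two_pow_mul_edgeCount_le (j := j) hG
  have h2 := le_two_pow_mul_edgeCount (j := j) (a := c + 1) hH
  have h3 : (c + 3) ^ j * ∏ i ∈ Finset.range j, (2 ^ i * c + 2) ≤
      (c + 2) ^ j * ∏ i ∈ Finset.range j, (2 ^ i * (c + 1) + 2) := by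
    have e : ∀ d : ℕ, d ^ j = ∏ _i ∈ Finset.range j, d := by simp
    rw [e, e, ← Finset.prod_mul_distrib, ← Finset.prod_mul_distrib]
    refine Finset.prod_le_prod' fun i _ => ?_
    have : 1 ≤ 2 ^ i := Nat.one_le_two_pow
    -- The difference of the two sides is `2 * 2 ^ i - 2`.
    nlinarith
  have h4 : 2 ^ m * (c + 2) ^ j ≤ (c + 3) ^ j := by
    rw [hj, pow_mul, pow_mul, ← mul_pow]
    exact Nat.pow_le_pow_left (two_mul_pow_le c) m
  have hP : 0 < ∏ i ∈ Finset.range j, (2 ^ i * c + 2) := Finset.prod_pos fun i _ => by positivity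
  set P := ∏ i ∈ Finset.range j, (2 ^ i * c + 2)
  set P' := ∏ i ∈ Finset.range j, (2 ^ i * (c + 1) + 2)
  have h5 : (c + 2) ^ j * (2 ^ j * edgeCount j G) < (c + 2) ^ j * (2 ^ j * edgeCount j H) :=
    calc (c + 2) ^ j * (2 ^ j * edgeCount j G) ≤ (c + 2) ^ j * (G.edgeSet.ncard * P) := by gcongr
      _ < (c + 2) ^ j * (2 ^ m * P) := by gcongr
      _ = 2 ^ m * (c + 2) ^ j * P := by ring
      _ ≤ (c + 3) ^ j * P := by gcongr
      _ ≤ (c + 2) ^ j * P' := h3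
      _ = (c + 2) ^ j * (1 * P') := by ring
      _ ≤ (c + 2) ^ j * (H.edgeSet.ncard * P') := by gcongr; exact hne
      _ ≤ _ := by gcongr
  exact lt_of_mul_lt_mul_left (lt_of_mul_lt_mul_left h5 (Nat.zero_le _)) (Nat.zero_le _)

/-- The part above `θ` is common to both graphs and cancels; `H` is edge-disjoint from it, so its
count adds to that part's. -/
theorem edgeCount_lt_of_dominating {V : Type u} [Finite V] {G G' H : SimpleGraph V} {φ : V → ℕ}
    {θ j : ℕ} (hφ : ∀ x y, G'.Adj x y → φ y ≤ φ x + 2)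
    (heq : restrictTo G' (fun x => θ < φ x) = restrictTo G (fun x => θ < φ x))
    (hH : H ≤ G) (hlow : ∀ x y, H.Adj x y → φ x ≤ θ)
    (hlt : edgeCount j (restrictTo G' (fun x => φ x ≤ θ + 2 * (j + 1))) < edgeCount j H) :
    edgeCount j G' < edgeCount j G := by
  have h1 := edgeCount_le_add (j := j) (G := G') (P := fun x => θ < φ x)
    (Q := fun t x => φ x ≤ θ + 2 * t) (s := 0)
    (fun a b hab x (hx : φ x ≤ θ + 2 * a) => show φ x ≤ θ + 2 * b by omega)
    (fun x y _ hx => by simpa using hx)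
    (fun t x y h hx => by have := hφ x y h; show φ y ≤ θ + 2 * (t + 1); omega)
  rw [zero_add, heq] at h1
  have h2 : edgeCount j H + edgeCount j (restrictTo G (fun x => θ < φ x)) ≤ edgeCount j G := by
    refine edgeCount_add_le hH (restrictTo_le _ _) ?_
    rw [Set.disjoint_left]
    intro e
    induction e with
    | _ x y =>
      intro hx hx'
      have h3 := hlow x y hx
      have h4 : θ < φ x := hx'.2.1
      omega
  omega

/-! ### Caterpillars and stars -/

/-- A path on `m + 1` vertices, with a leaf `l` attached to the vertex at position `f l`. -/
def caterpillar (m : ℕ) {Λ : Type u} (f : Λ → ℕ) : SimpleGraph (Fin (m + 1) ⊕ Λ) where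
  Adj
    | .inl a, .inl b => a.val + 1 = b.val ∨ b.val + 1 = a.val
    | .inl a, .inr l => a.val = f l
    | .inr l, .inl a => a.val = f l
    | .inr _, .inr _ => False
  symm := ⟨by rintro (a | l) (b | l') h <;> simp_all [or_comm]⟩
  loopless := ⟨by rintro (a | l) h <;> simp_all⟩

theorem caterpillar_isTree {m : ℕ} {Λ : Type u} [Finite Λ] {f : Λ → ℕ} (hf : ∀ l, f l ≤ m) :
    (caterpillar m f).IsTree := by
  have := Fintype.ofFinite Λ
  have hspine : ∀ k (hk : k < m + 1),
      (caterpillar m f).Reachable (.inl 0) (.inl ⟨k, hk⟩) := by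
    intro k
    induction k with
    | zero => intro _; exact SimpleGraph.Reachable.refl _
    | succ k ih =>
      intro hk
      exact (ih (by omega)).trans (SimpleGraph.Adj.reachable (Or.inl rfl))
  have hroot : ∀ x, (caterpillar m f).Reachable (.inl 0) x := by
    rintro (a | l)
    · exact hspine a.1 a.2
    · refine (hspine (f l) (Nat.lt_succ_of_le (hf l))).trans (SimpleGraph.Adj.reachable ?_)
      exact (rfl : f l = f l)
  have hconn : (caterpillar m f).Connected :=
    { preconnected := fun x y => (hroot x).symm.trans (hroot y), nonempty := ⟨.inl 0⟩ }
  refine SimpleGraph.isTree_iff_connected_and_card.2 ⟨hconn, ?_⟩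
  refine le_antisymm ?_ hconn.card_vert_le_card_edgeSet_add_one
  let g : Fin m ⊕ Λ → Sym2 (Fin (m + 1) ⊕ Λ) :=
    Sum.elim (fun a => s(.inl a.castSucc, .inl a.succ))
      (fun l => s(.inl ⟨f l, Nat.lt_succ_of_le (hf l)⟩, .inr l))
  have hsub : (caterpillar m f).edgeSet ⊆ Set.range g := by
    have key : ∀ a b : Fin (m + 1), a.val + 1 = b.val →
        (s(.inl a, .inl b) : Sym2 (Fin (m + 1) ⊕ Λ)) ∈ Set.range g := by
      intro a b hab
      refine ⟨.inl ⟨a.val, by omega⟩, ?_⟩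
      have h1 : (⟨a.val, by omega⟩ : Fin m).castSucc = a := rfl
      have h2 : (⟨a.val, by omega⟩ : Fin m).succ = b := Fin.ext hab
      simp only [g, Sum.elim_inl, h1, h2]
    have key' : ∀ (a : Fin (m + 1)) (l : Λ), a.val = f l →
        (s(.inl a, .inr l) : Sym2 (Fin (m + 1) ⊕ Λ)) ∈ Set.range g := by
      intro a l hal
      refine ⟨.inr l, ?_⟩
      have h1 : (⟨f l, Nat.lt_succ_of_le (hf l)⟩ : Fin (m + 1)) = a := Fin.ext hal.symm
      simp only [g, Sum.elim_inr, h1]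
    intro e
    induction e with
    | _ x y =>
      intro h
      rw [SimpleGraph.mem_edgeSet] at h
      rcases x with a | l <;> rcases y with b | l'
      · rcases h with h | h
        · exact key _ _ h
        · rw [Sym2.eq_swap]; exact key _ _ h
      · exact key' _ _ h
      · rw [Sym2.eq_swap]; exact key' _ _ h
      · exact h.elim
  have h1 : Nat.card (caterpillar m f).edgeSet ≤ Nat.card (Fin m ⊕ Λ) := by
    rw [Nat.card_coe_set_eq]
    refine (Set.ncard_le_ncard hsub).trans ?_
    rw [← Set.image_univ, ← Set.ncard_univ]
    exact Set.ncard_image_le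
  simp only [Nat.card_eq_fintype_card, Fintype.card_sum, Fintype.card_fin] at h1 ⊢
  omega

theorem ncard_neighborSet_caterpillar_inr_le {m : ℕ} {Λ : Type u} [Finite Λ] (f : Λ → ℕ) (l : Λ) :
    ((caterpillar m f).neighborSet (.inr l)).ncard ≤ 1 := by
  refine (Set.ncard_le_one (Set.toFinite _)).2 ?_
  rintro (a | l') ha (b | l'') hb
  · have ha' : a.val = f l := ha
    have hb' : b.val = f l := hb
    rw [Fin.ext (ha'.trans hb'.symm)]
  · exact hb.elim
  · exact ha.elim
  · exact ha.elim

theorem ncard_neighborSet_caterpillar_inl_le {m : ℕ} {Λ : Type u} [Finite Λ] (f : Λ → ℕ)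
    (a : Fin (m + 1)) :
    ((caterpillar m f).neighborSet (.inl a)).ncard ≤ 2 + {l | f l = a.val}.ncard := by
  have hsub : (caterpillar m f).neighborSet (.inl a) ⊆
      Sum.inl '' {b : Fin (m + 1) | a.val + 1 = b.val ∨ b.val + 1 = a.val} ∪
        Sum.inr '' {l | f l = a.val} := by
    rintro (b | l) h
    · exact Or.inl ⟨b, h, rfl⟩
    · exact Or.inr ⟨l, (show a.val = f l from h).symm, rfl⟩
  have h2 : {b : Fin (m + 1) | a.val + 1 = b.val ∨ b.val + 1 = a.val}.ncard ≤ 2 := by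
    rw [← Set.ncard_image_of_injective _ Fin.val_injective]
    refine (Set.ncard_le_ncard (t := {a.val + 1, a.val - 1}) ?_).trans ((Set.ncard_insert_le _ _).trans (by simp))
    rintro _ ⟨b, hb | hb, rfl⟩
    · exact Or.inl hb.symm
    · exact Or.inr (show b.val = a.val - 1 by omega)
  refine (Set.ncard_le_ncard hsub).trans ((Set.ncard_union_le _ _).trans ?_)
  exact add_le_add ((Set.ncard_image_le).trans h2) Set.ncard_image_le

/-- The edges of `G` at `z`. -/
def starAt {V : Type u} (G : SimpleGraph V) (z : V) : SimpleGraph V where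
  Adj x y := G.Adj x y ∧ (x = z ∨ y = z)
  symm := ⟨fun _ _ ⟨h, hz⟩ => ⟨h.symm, hz.symm⟩⟩
  loopless := ⟨fun _ h => h.1.ne rfl⟩

theorem le_ncard_neighborSet_starAt {V : Type u} [Finite V] {G : SimpleGraph V} {z x y : V}
    (h : (starAt G z).Adj x y) :
    (G.neighborSet z).ncard + 1 ≤
      ((starAt G z).neighborSet x).ncard + ((starAt G z).neighborSet y).ncard := by
  have hz : (starAt G z).neighborSet z = G.neighborSet z := by
    ext w
    simp [starAt]
  have h1 : 1 ≤ ((starAt G z).neighborSet x).ncard := (Set.ncard_pos (Set.toFinite _)).2 ⟨y, h⟩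
  have h2 : 1 ≤ ((starAt G z).neighborSet y).ncard := (Set.ncard_pos (Set.toFinite _)).2 ⟨x, h.symm⟩
  rcases h.2 with rfl | rfl
  · rw [hz] at h1 ⊢; omega
  · rw [hz] at h2 ⊢; omega

/-! ### The coding caterpillars and their degrees -/

/-- Blocks of leaves, the `i`-th of size `2 * i + 4`, and some further leaves. -/
abbrev CodeLeaf (K pad : ℕ) : Type := (Σ i : Fin K, Fin (2 * i.val + 4)) ⊕ Fin pad

/-- The `i`-th block of leaves is attached to the path at `(i + 1) * R`, but for two leaves that
move to `(i + 1) * R + 2` when the `i`-th bit is off. The further leaves sit at `(K + 1) * R`. -/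
def codeAttach {K : ℕ} (R pad : ℕ) (S : Fin K → Bool) : CodeLeaf K pad → ℕ
  | .inl ⟨i, t⟩ => (i.val + 1) * R + if t.val < 2 ∧ S i = false then 2 else 0
  | .inr _ => (K + 1) * R

/-- The caterpillar coding a string of bits. -/
def codeTree {K : ℕ} (R pad : ℕ) (S : Fin K → Bool) :
    SimpleGraph (Fin ((K + 1) * R + 1) ⊕ CodeLeaf K pad) :=
  caterpillar ((K + 1) * R) (codeAttach R pad S)

/-- A position along the path, which for leaves depends on the block only. -/
def codePos {K R pad : ℕ} : Fin ((K + 1) * R + 1) ⊕ CodeLeaf K pad → ℕ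
  | .inl a => a.val
  | .inr (.inl ⟨i, _⟩) => (i.val + 1) * R
  | .inr (.inr _) => (K + 1) * R

theorem codeAttach_bounds {K R pad : ℕ} (S : Fin K → Bool) (l : CodeLeaf K pad) :
    codePos (R := R) (.inr l) ≤ codeAttach R pad S l ∧
      codeAttach R pad S l ≤ codePos (R := R) (.inr l) + 2 := by
  rcases l with ⟨i, t⟩ | q
  · simp only [codePos, codeAttach]
    split_ifs <;> omega
  · simp [codePos, codeAttach]

theorem succ_mul_add_le {a b R : ℕ} (h : a < b) : (a + 1) * R + R ≤ (b + 1) * R := by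
  have := Nat.mul_le_mul_right R (show a + 2 ≤ b + 1 by omega)
  linarith [this, show (a + 2) * R = (a + 1) * R + R by ring]

theorem codeTree_isTree {K R pad : ℕ} (hR : 5 ≤ R) (S : Fin K → Bool) :
    (codeTree R pad S).IsTree := by
  refine caterpillar_isTree fun l => ?_
  rcases l with ⟨i, t⟩ | q
  · have := succ_mul_add_le (R := R) i.isLt
    simp only [codeAttach]
    split_ifs <;> omega
  · exact le_rfl

theorem codePos_le_of_adj {K R pad : ℕ} (S : Fin K → Bool) (x y)
    (h : (codeTree R pad S).Adj x y) : codePos y ≤ codePos x + 2 := by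
  rcases x with a | l <;> rcases y with b | l'
  · rcases h with h | h <;> simp only [codePos] <;> omega
  · have h' : a.val = codeAttach R pad S l' := h
    have := codeAttach_bounds (R := R) S l'
    rw [show codePos (R := R) (.inl a : Fin ((K + 1) * R + 1) ⊕ CodeLeaf K pad) = a.val from rfl]
    omega
  · have h' : b.val = codeAttach R pad S l := h
    have := codeAttach_bounds (R := R) S l
    rw [show codePos (R := R) (.inl b : Fin ((K + 1) * R + 1) ⊕ CodeLeaf K pad) = b.val from rfl]
    omega
  · exact h.elim

theorem exists_block_of_codeAttach_lt {K R pad : ℕ} {S : Fin K → Bool} {i : Fin K}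
    {l : CodeLeaf K pad} (h : codeAttach R pad S l < (i.val + 2) * R) :
    ∃ k t, l = .inl ⟨k, t⟩ ∧ k ≤ i := by
  have hmono : ∀ k, i.val < k → (i.val + 2) * R ≤ (k + 1) * R := fun k hk =>
    Nat.mul_le_mul_right R (by omega)
  rcases l with ⟨k, t⟩ | q
  · refine ⟨k, t, rfl, ?_⟩
    by_contra hk
    have := hmono k (by simpa using hk)
    simp only [codeAttach] at h
    omega
  · have := hmono K i.isLt
    simp only [codeAttach] at h
    omega

theorem block_eq_of_codeAttach_le {K R pad : ℕ} (hR : 5 ≤ R) {S : Fin K → Bool} {k k' : Fin K}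
    {t t'} (h1 : codeAttach R pad S (.inl ⟨k, t⟩) ≤ codeAttach R pad S (.inl ⟨k', t'⟩) + 1)
    (h2 : codeAttach R pad S (.inl ⟨k', t'⟩) ≤ codeAttach R pad S (.inl ⟨k, t⟩) + 1) : k = k' := by
  have e1 := codeAttach_bounds (R := R) (pad := pad) S (.inl ⟨k, t⟩)
  have e2 := codeAttach_bounds (R := R) (pad := pad) S (.inl ⟨k', t'⟩)
  simp only [codePos] at e1 e2
  rcases lt_trichotomy k k' with h | h | h
  · have := succ_mul_add_le (R := R) (show k.val < k'.val from h)
    omega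
  · exact h
  · have := succ_mul_add_le (R := R) (show k'.val < k.val from h)
    omega

/-- Block `i` is split into 2 and `2 * i + 2` leaves, an earlier block has at most `2 * i + 2` in
all, and later ones start at `(i + 2) * R`. -/
theorem ncard_codeAttach_le {K R pad : ℕ} (hR : 5 ≤ R) {S : Fin K → Bool} {i : Fin K}
    (hi : S i = false) {a : ℕ} (ha : a < (i.val + 2) * R) :
    {l : CodeLeaf K pad | codeAttach R pad S l = a}.ncard ≤ 2 * i.val + 2 := by
  rcases Set.eq_empty_or_nonempty {l : CodeLeaf K pad | codeAttach R pad S l = a} with h | ⟨l, hl⟩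
  · rw [h]; simp
  have hl' : codeAttach R pad S l = a := hl
  obtain ⟨k, t, rfl, hk⟩ := exists_block_of_codeAttach_lt (hl'.trans_lt ha)
  have hblock : ∀ l' : CodeLeaf K pad, codeAttach R pad S l' = a → ∃ t', l' = .inl ⟨k, t'⟩ := by
    intro l' h'
    obtain ⟨k', t', rfl, -⟩ := exists_block_of_codeAttach_lt (h'.trans_lt ha)
    obtain rfl := block_eq_of_codeAttach_le hR (show codeAttach R pad S (.inl ⟨k, t⟩) ≤
      codeAttach R pad S (.inl ⟨k', t'⟩) + 1 by omega) (by omega)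
    exact ⟨t', rfl⟩
  let g : Fin (2 * k.val + 4) → CodeLeaf K pad := fun t' => .inl ⟨k, t'⟩
  have hcard : ∀ T : Set (Fin (2 * k.val + 4)),
      {l : CodeLeaf K pad | codeAttach R pad S l = a} ⊆ g '' T →
      {l : CodeLeaf K pad | codeAttach R pad S l = a}.ncard ≤ (Fin.val '' T).ncard := by
    intro T hT
    rw [Set.ncard_image_of_injective _ Fin.val_injective]
    exact (Set.ncard_le_ncard hT).trans Set.ncard_image_le
  rcases hk.lt_or_eq with hk | rfl
  · have hk' : k.val < i.val := hk
    refine (hcard Set.univ ?_).trans ((Set.ncard_image_le).trans ?_)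
    · intro l' h'
      obtain ⟨t', rfl⟩ := hblock l' h'
      exact ⟨t', trivial, rfl⟩
    · rw [Set.ncard_univ, Nat.card_fin]
      omega
  · by_cases ht : t.val < 2
    · refine (hcard {t' | t'.val < 2} ?_).trans ?_
      · intro l' h'
        obtain ⟨t', rfl⟩ := hblock l' h'
        refine ⟨t', ?_, rfl⟩
        by_contra hn
        have h'' : codeAttach R pad S (.inl ⟨k, t'⟩) = a := h'
        simp only [Set.mem_ofPred_eq] at hn
        simp [codeAttach, hi, ht, hn] at h'' hl'
        omega
      · refine (Set.ncard_le_ncard (t := Set.Iio 2) ?_).trans ?_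
        · rintro _ ⟨t', h', rfl⟩
          exact h'
        · simp
    · refine (hcard {t' | 2 ≤ t'.val} ?_).trans ?_
      · intro l' h'
        obtain ⟨t', rfl⟩ := hblock l' h'
        refine ⟨t', ?_, rfl⟩
        by_contra hn
        have h'' : codeAttach R pad S (.inl ⟨k, t'⟩) = a := h'
        simp only [Set.mem_ofPred_eq, not_le] at hn
        simp [codeAttach, hi, ht, hn] at h'' hl'
        omega
      · refine (Set.ncard_le_ncard (t := Set.Ico 2 (2 * k.val + 4)) ?_).trans ?_
        · rintro _ ⟨t', h', rfl⟩
          exact ⟨h', t'.isLt⟩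
        · simp

/-- Two adjacent spine vertices never both carry leaves: blocks are far apart, and the displaced
leaves sit two places away, not one. So one of the two has degree at most 2. -/
theorem codeTree_degree_add_le {K R pad : ℕ} (hR : 5 ≤ R) {S : Fin K → Bool} {i : Fin K}
    (hi : S i = false) {x y : Fin ((K + 1) * R + 1) ⊕ CodeLeaf K pad}
    (h : (codeTree R pad S).Adj x y) (hx : codePos x < (i.val + 2) * R)
    (hy : codePos y < (i.val + 2) * R) :
    ((codeTree R pad S).neighborSet x).ncard + ((codeTree R pad S).neighborSet y).ncard ≤
      2 * i.val + 6 := by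
  have hspine : ∀ a : Fin ((K + 1) * R + 1), a.val < (i.val + 2) * R →
      ((codeTree R pad S).neighborSet (.inl a)).ncard ≤ 2 * i.val + 4 := by
    intro a ha
    have h1 := ncard_neighborSet_caterpillar_inl_le (codeAttach R pad S) a
    have h2 := ncard_codeAttach_le (pad := pad) hR hi ha
    rw [codeTree]
    omega
  have hleaf : ∀ l, ((codeTree R pad S).neighborSet (.inr l)).ncard ≤ 1 := fun l =>
    ncard_neighborSet_caterpillar_inr_le _ l
  rcases x with a | l <;> rcases y with b | l'
  · have hx' : a.val < (i.val + 2) * R := hx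
    have hy' : b.val < (i.val + 2) * R := hy
    have a1 := ncard_neighborSet_caterpillar_inl_le (codeAttach R pad S) a
    have b1 := ncard_neighborSet_caterpillar_inl_le (codeAttach R pad S) b
    have a2 := ncard_codeAttach_le (pad := pad) hR hi hx'
    have b2 := ncard_codeAttach_le (pad := pad) hR hi hy'
    rw [← codeTree] at a1 b1
    rcases Set.eq_empty_or_nonempty {l : CodeLeaf K pad | codeAttach R pad S l = a.val} with
      ha | ⟨l, hl⟩
    · rw [ha, Set.ncard_empty] at a1
      omega
    rcases Set.eq_empty_or_nonempty {l : CodeLeaf K pad | codeAttach R pad S l = b.val} with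
      hb | ⟨l', hl'⟩
    · rw [hb, Set.ncard_empty] at b1
      omega
    exfalso
    have hl : codeAttach R pad S l = a.val := hl
    have hl' : codeAttach R pad S l' = b.val := hl'
    obtain ⟨k, t, rfl, -⟩ := exists_block_of_codeAttach_lt (hl.trans_lt hx')
    obtain ⟨k', t', rfl, -⟩ := exists_block_of_codeAttach_lt (hl'.trans_lt hy')
    have hab : a.val + 1 = b.val ∨ b.val + 1 = a.val := h
    obtain rfl := block_eq_of_codeAttach_le hR (show codeAttach R pad S (.inl ⟨k, t⟩) ≤
      codeAttach R pad S (.inl ⟨k', t'⟩) + 1 by omega) (by omega)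
    simp only [codeAttach] at hl hl'
    split_ifs at hl hl' <;> omega
  · have := hspine a hx
    have := hleaf l'
    omega
  · have := hspine b hy
    have := hleaf l
    omega
  · exact h.elim

theorem le_ncard_neighborSet_codeTree {K R pad : ℕ} (hR : 5 ≤ R) {S : Fin K → Bool} {i : Fin K}
    (hi : S i = true) {z : Fin ((K + 1) * R + 1)} (hz : z.val = (i.val + 1) * R) :
    2 * i.val + 6 ≤ ((codeTree R pad S).neighborSet (.inl z)).ncard := by
  have hlt := succ_mul_add_le (R := R) i.isLt
  have hpos : R ≤ (i.val + 1) * R := Nat.le_mul_of_pos_left R (Nat.succ_pos _)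
  let g : Bool ⊕ Fin (2 * i.val + 4) → Fin ((K + 1) * R + 1) ⊕ CodeLeaf K pad :=
    Sum.elim (fun b => .inl (if b then ⟨z.val + 1, by omega⟩ else ⟨z.val - 1, by omega⟩))
      (fun t => .inr (.inl ⟨i, t⟩))
  have hg : Function.Injective g := by
    rintro (b | t) (b' | t') h
    · cases b <;> cases b' <;> simp [g] at h ⊢; omega
    · simp [g] at h
    · simp [g] at h
    · simpa [g] using h
  have hsub : Set.range g ⊆ (codeTree R pad S).neighborSet (.inl z) := by
    rintro _ ⟨b | t, rfl⟩
    · cases b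
      · exact Or.inr (show z.val - 1 + 1 = z.val by omega)
      · exact Or.inl rfl
    · show z.val = codeAttach R pad S (.inl ⟨i, t⟩)
      simp [codeAttach, hi, hz]
  have h1 := Set.ncard_le_ncard hsub
  rw [← Set.image_univ, Set.ncard_image_of_injective _ hg, Set.ncard_univ] at h1
  simp only [Nat.card_eq_fintype_card, Fintype.card_sum, Fintype.card_bool, Fintype.card_fin] at h1
  omega

/-- Leaves beyond the cut belong to blocks after `i`. As `codePos` ignores the bits, the cut is the
same vertex set for both strings. -/
theorem restrictTo_codeTree_le {K R pad : ℕ} {S S' : Fin K → Bool} {i : Fin K}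
    (hagree : ∀ k, i < k → S k = S' k) :
    restrictTo (codeTree R pad S) (fun x => (i.val + 1) * R + 2 < codePos x) ≤
      restrictTo (codeTree R pad S') (fun x => (i.val + 1) * R + 2 < codePos x) := by
  have key : ∀ l : CodeLeaf K pad, (i.val + 1) * R + 2 < codePos (R := R) (.inr l) →
      codeAttach R pad S l = codeAttach R pad S' l := by
    rintro (⟨k, t⟩ | q) h
    · simp only [codePos] at h
      have hk : i < k := by
        by_contra hk
        have : (k.val + 1) * R ≤ (i.val + 1) * R :=
          Nat.mul_le_mul_right R (Nat.succ_le_succ (not_lt.1 hk))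
        omega
      simp only [codeAttach, hagree k hk]
    · rfl
  rintro x y ⟨h, hx, hy⟩
  refine ⟨?_, hx, hy⟩
  rcases x with a | l <;> rcases y with b | l'
  · exact h
  · exact (show a.val = codeAttach R pad S l' from h).trans (key l' hy)
  · exact (show b.val = codeAttach R pad S l from h).trans (key l hx)
  · exact h

/-! ### Separating the codes -/

theorem edgeCount_codeTree_lt {K R pad m : ℕ} {S S' : Fin K → Bool} {i : Fin K}
    (hi : S i = true) (hi' : S' i = false) (hagree : ∀ k, i < k → S k = S' k)
    (hm : (codeTree R pad S').edgeSet.ncard < 2 ^ m) (hR : 2 * ((2 * i.val + 4) * m) + 5 ≤ R) :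
    edgeCount ((2 * i.val + 4) * m) (codeTree R pad S') <
      edgeCount ((2 * i.val + 4) * m) (codeTree R pad S) := by
  have hR5 : 5 ≤ R := by omega
  have hlt := succ_mul_add_le (R := R) i.isLt
  set z : Fin ((K + 1) * R + 1) := ⟨(i.val + 1) * R, by omega⟩ with hz
  have hdeg := le_ncard_neighborSet_codeTree (pad := pad) hR5 hi (z := z) rfl
  refine edgeCount_lt_of_dominating (H := starAt (codeTree R pad S) (.inl z)) (φ := codePos)
    (θ := (i.val + 1) * R + 2) (codePos_le_of_adj S')
    (le_antisymm (restrictTo_codeTree_le fun k hk => (hagree k hk).symm)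
      (restrictTo_codeTree_le hagree)) (fun _ _ h => h.1) ?_ ?_
  · rintro x y ⟨h, rfl | rfl⟩
    · exact Nat.le_add_right _ _
    · exact codePos_le_of_adj S _ _ h.symm
  · refine edgeCount_lt_edgeCount (c := 2 * i.val + 2) ?_ ?_ ?_ ?_
    · obtain ⟨y, hy⟩ := (Set.ncard_pos (Set.toFinite _)).1 (lt_of_lt_of_le (Nat.succ_pos _) hdeg)
      exact (Set.ncard_pos (Set.toFinite _)).2 ⟨s(.inl z, y), hy, Or.inl rfl⟩
    · intro x y h
      have := le_ncard_neighborSet_starAt h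
      omega
    · rintro x y ⟨h, hx, hy⟩
      have e : (i.val + 2) * R = (i.val + 1) * R + R := by ring
      -- The window ends at `(i + 1) * R + 2 * j + 4` with `j = (2 * i + 4) * m`; `hR` keeps this
      -- below the next block.
      have h1 := codeTree_degree_add_le hR5 hi' h (by omega) (by omega)
      have h2 : ∀ w, ((restrictTo (codeTree R pad S') (fun x => codePos x ≤ (i.val + 1) * R + 2 +
          2 * ((2 * i.val + 4) * m + 1))).neighborSet w).ncard ≤
          ((codeTree R pad S').neighborSet w).ncard := fun w =>
        Set.ncard_le_ncard fun _ h => h.1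
      exact (add_le_add (h2 x) (h2 y)).trans h1
    · exact (Set.ncard_le_ncard (SimpleGraph.edgeSet_mono (restrictTo_le _ _))).trans_lt hm

theorem edgeCount_codeTree_injective {K R pad : ℕ}
    (hR : 2 * ((2 * K + 2) * K) + 5 ≤ R)
    (hn : Nat.card (Fin ((K + 1) * R + 1) ⊕ CodeLeaf K pad) < 2 ^ K) {S S' : Fin K → Bool}
    (h : ∀ j, edgeCount j (codeTree R pad S) = edgeCount j (codeTree R pad S')) : S = S' := by
  have hedge : ∀ S : Fin K → Bool, (codeTree R pad S).edgeSet.ncard < 2 ^ K := by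
    intro S
    have h1 := (SimpleGraph.isTree_iff_connected_and_card.1
      (codeTree_isTree (pad := pad) (show 5 ≤ R by omega) S)).2
    rw [Nat.card_coe_set_eq] at h1
    omega
  by_contra hne
  obtain ⟨k, hk⟩ := Function.ne_iff.1 hne
  obtain ⟨i, hi, hmax⟩ := Finset.exists_max_image (Finset.univ.filter fun k => S k ≠ S' k) id
    ⟨k, by simpa using hk⟩
  have hi' : S i ≠ S' i := by simpa using hi
  have hagree : ∀ k, i < k → S k = S' k := by
    intro k hk
    by_contra hk'
    exact absurd (hmax k (by simpa using hk')) (not_le.2 hk)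
  have hRi : 2 * ((2 * i.val + 4) * K) + 5 ≤ R := by
    have : (2 * i.val + 4) * K ≤ (2 * K + 2) * K := Nat.mul_le_mul_right K (by omega)
    omega
  cases hS : S i <;> cases hS' : S' i
  · exact hi' (hS.trans hS'.symm)
  · exact (edgeCount_codeTree_lt hS' hS (fun k hk => (hagree k hk).symm) (hedge S) hRi).ne (h _)
  · exact (edgeCount_codeTree_lt hS hS' hagree (hedge S') hRi).ne (h _).symm
  · exact hi' (hS.trans hS'.symm)

theorem two_pow_le_numGrahamClasses {n K : ℕ} (hK : 1 ≤ K) (hn : n < 2 ^ K)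
    (hKn : 33 * K ^ 3 ≤ n) : 2 ^ K ≤ numGrahamClasses n := by
  obtain ⟨R, hR⟩ : ∃ R, R = 2 * ((2 * K + 2) * K) + 5 := ⟨_, rfl⟩
  have hblocks : Fintype.card (Σ i : Fin K, Fin (2 * i.val + 4)) ≤ K * (2 * K + 4) := by
    rw [Fintype.card_sigma]
    refine (Finset.sum_le_card_nsmul _ _ (2 * K + 4) fun i _ => ?_).trans (by simp)
    rw [Fintype.card_fin]
    omega
  have hbase : (K + 1) * R + 1 + Fintype.card (Σ i : Fin K, Fin (2 * i.val + 4)) ≤ n := by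
    have h2 : K ≤ K ^ 2 := Nat.le_self_pow two_ne_zero K
    have h3 : K ^ 2 ≤ K ^ 3 := Nat.pow_le_pow_right hK (by norm_num)
    -- The left side is `4 * K ^ 3 + 10 * K ^ 2 + 13 * K + 6`, and 4 + 10 + 13 + 6 = 33.
    have : (K + 1) * R + 1 + K * (2 * K + 4) ≤ 33 * K ^ 3 := by
      rw [hR]
      ring_nf
      nlinarith
    omega
  obtain ⟨pad, hpad⟩ := Nat.exists_eq_add_of_le hbase
  have hcard : Fintype.card (Fin ((K + 1) * R + 1) ⊕ CodeLeaf K pad) = n := by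
    rw [hpad, Fintype.card_sum, Fintype.card_sum, Fintype.card_fin, Fintype.card_fin, ← add_assoc]
  let e := Fintype.equivFinOfCardEq hcard
  let tree : (Fin K → Bool) → TreeOn n := fun S =>
    ⟨(codeTree R pad S).map e.toEmbedding, (SimpleGraph.Iso.map e _).isTree_iff.1
      (codeTree_isTree (by omega) S)⟩
  have hinj : Function.Injective fun S => (Quotient.mk (grahamSetoid n) (tree S)) := by
    intro S S' h
    have h' : GrahamEquivalent (tree S).1 (tree S').1 := Quotient.exact h
    refine edgeCount_codeTree_injective (pad := pad) hR.ge ?_ fun j => ?_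
    · rw [Nat.card_eq_fintype_card, hcard]
      exact hn
    · have hj := h' (j + 1)
      rw [iteratedLineGraphOrder_succ, iteratedLineGraphOrder_succ] at hj
      exact (edgeCount_map _ _).symm.trans (hj.trans (edgeCount_map _ _))
  have : Finite (TreeOn n) := Subtype.finite
  have h1 := Nat.card_le_card_of_injective _ hinj
  simpa [numGrahamClasses] using h1

/-! ### Asymptotics -/

theorem eventually_mul_log_pow_le : ∀ᶠ n : ℕ in atTop, 33 * ((Nat.log 2 n + 1) ^ 2) ^ 3 ≤ n := by
  have h1 : Tendsto (fun n : ℕ => Nat.log 2 n + 1) atTop atTop := by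
    refine tendsto_atTop_mono (fun n => Nat.le_succ _) ?_
    refine tendsto_atTop_atTop.2 fun b => ⟨2 ^ b, fun n hn => ?_⟩
    exact Nat.le_log_of_pow_le one_lt_two hn
  have h2 := (tendsto_pow_const_div_const_pow_of_one_lt 6 (one_lt_two : (1 : ℝ) < 2)).comp h1
  filter_upwards [h2.eventually (gt_mem_nhds (show (0 : ℝ) < 1 / 66 by norm_num)),
    eventually_ge_atTop 1] with n hn hn1
  have hlog : 2 ^ Nat.log 2 n ≤ n := Nat.pow_log_le_self 2 (by omega)
  simp only [Function.comp] at hn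
  rw [div_lt_iff₀ (by positivity)] at hn
  have h3 : 66 * (Nat.log 2 n + 1) ^ 6 ≤ 2 ^ (Nat.log 2 n + 1) := by
    have : (66 : ℝ) * ((Nat.log 2 n + 1 : ℕ) : ℝ) ^ 6 ≤ 2 ^ (Nat.log 2 n + 1) := by linarith
    exact_mod_cast this
  rw [pow_succ 2] at h3
  rw [← pow_mul, show 2 * 3 = 6 from rfl]
  omega

theorem theorem1 :
    ∃ c : ℝ, 0 < c ∧
      (fun n : ℕ => Real.exp (c * (Real.log (n : ℝ)) ^ (3 / 2 : ℝ))) =O[atTop]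
        (fun n : ℕ => (numGrahamClasses n : ℝ)) := by
  refine ⟨1, one_pos, IsBigO.of_bound 1 ?_⟩
  filter_upwards [eventually_mul_log_pow_le,
    (Real.tendsto_log_atTop.comp tendsto_natCast_atTop_atTop).eventually_ge_atTop 1,
    eventually_ge_atTop 1] with n hn hlog hn1
  simp only [Function.comp] at hlog
  set l := Nat.log 2 n + 1 with hl
  have hnl : n < 2 ^ l := Nat.lt_pow_succ_log_self one_lt_two n
  have hclasses : 2 ^ l ^ 2 ≤ numGrahamClasses n :=
    two_pow_le_numGrahamClasses (Nat.one_le_pow _ _ (Nat.succ_pos _))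
      (hnl.trans_le (Nat.pow_le_pow_right two_pos (Nat.le_self_pow two_ne_zero l))) hn
  have hlog2 : Real.log n ≤ l * Real.log 2 := by
    rw [← Real.log_pow]
    exact Real.log_le_log (by exact_mod_cast hn1) (by exact_mod_cast hnl.le)
  have h2pos : 0 < Real.log 2 := Real.log_pos one_lt_two
  have h2le : Real.log 2 ≤ 1 := by linarith [Real.log_two_lt_d9]
  -- The count reaches exponent 2 in `log n`, so `c = 1` suffices for 3/2.
  have hexp : 1 * Real.log n ^ (3 / 2 : ℝ) ≤ (l ^ 2 : ℕ) * Real.log 2 :=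
    calc 1 * Real.log n ^ (3 / 2 : ℝ) ≤ Real.log n ^ (2 : ℝ) := by
          rw [one_mul]
          exact Real.rpow_le_rpow_of_exponent_le hlog (by norm_num)
      _ = Real.log n ^ 2 := by norm_cast
      _ ≤ (l * Real.log 2) ^ 2 := by gcongr
      _ = (l : ℝ) ^ 2 * (Real.log 2 * Real.log 2) := by ring
      _ ≤ (l : ℝ) ^ 2 * (1 * Real.log 2) := by gcongr
      _ = _ := by push_cast; ring
  rw [one_mul (‖_‖), Real.norm_of_nonneg (Real.exp_pos _).le, Real.norm_of_nonneg (Nat.cast_nonneg _)]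
  calc _ ≤ Real.exp ((l ^ 2 : ℕ) * Real.log 2) := Real.exp_le_exp.2 hexp
    _ = ((2 ^ l ^ 2 : ℕ) : ℝ) := by
        rw [← Real.log_pow, Real.exp_log (by positivity)]
        push_cast
        rfl
    _ ≤ (numGrahamClasses n : ℝ) := by exact_mod_cast hclasses
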